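/- Let $q$ be a prime with $8 \mid q+1$. A binary quadratic residue code of length $q$ is a set of all words $c=(c_j)_{j\in\mathbb{Z}/q}\in\mathbb{F}_2^{q}$ such that $\sum_{j=0}^{q-1} c_j\alpha^{rj}=0$ for every nonzero quadratic residue $r$ modulo $q$, where $\alpha$ is some primitive $q$-th root of unity in an algebraic closure of $\mathbb{F}_2$. Then: (i) the linear code spanned by all cyclic shifts of the word that has a $1$ in place $j$ if and only if $j$ is a nonzero quadratic residue modulo $q$ is a quadratic residue code, and any two binary quadratic residue codes of length $q$ are isomorphic, i.e. equal up to a permutation of the coordinates. Moreover, every binary quadratic residue code $\mathcal{C}$ of length $q$ satisfies: (ii) $\dim_{\mathbb{F}_2}\mathcal{C}=(q+1)/2$; (iii) for a uniformly random codeword $c\in\mathcal{C}$ with Hamming weight $\mathrm{wt}(c)$, $\mathbb{E}_{c}\bigl[\cos^2\bigl(\tfrac{\pi}{8}(q-2\,\mathrm{wt}(c))\bigr)\bigr]=\cos^2(\pi/8)$, and $\cos^2(\pi/8)$ is $0.854$ to three decimals ($|\cos^2(\pi/8)-0.854|<0.0005$); (iv) for two independent uniformly random codewords $c_1,c_2\in\mathcal{C}$,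 $\mathbb{P}(c_1\cdot c_2=0)=3/4$, where the dot product is taken in $\mathbb{F}_2$. -/

import Mathlib

/-- Binary linear codes of length `q`; the coordinates are labelled by the residues mod `q`. -/
abbrev BinaryCode (q : ℕ) : Type := Submodule (ZMod 2) (ZMod q → ZMod 2)

open Classical in
/-- The word with a `1` in place `j` if and only if `j` is a nonzero quadratic residue mod `q`. -/
noncomputable def residueWord (q : ℕ) : ZMod q → ZMod 2 :=
  fun j => if j ≠ 0 ∧ IsSquare j then 1 else 0

/-- The code spanned by all the rotations (cyclic shifts) of the word `g`. -/
def cyclicSpan {q : ℕ} (g : ZMod q → ZMod 2) : BinaryCode q :=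
  Submodule.span (ZMod 2) (Set.range fun (s : ZMod q) (j : ZMod q) => g (j - s))

/-- The cyclic code generated by the indicator word of the nonzero quadratic residues. -/
noncomputable def residueCode (q : ℕ) : BinaryCode q := cyclicSpan (residueWord q)

/-- The classical definition, for an odd prime `q` modulo which `2` is a quadratic residue:
a quadratic residue code consists of the words `c` whose polynomial `∑ⱼ cⱼ xʲ` vanishes at `α ^ r`
for every nonzero quadratic residue `r`, where `α` is some primitive `q`-th root of unity over
`𝔽₂`. All choices of `α` are allowed (a non-residue power of `α` exchanges residues and
non-residues). -/
def IsQuadraticResidueCode (q : ℕ) [NeZero q] (C : BinaryCode q) : Prop :=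
  ∃ α : AlgebraicClosure (ZMod 2), IsPrimitiveRoot α q ∧
    ∀ c : ZMod q → ZMod 2, c ∈ C ↔
      ∀ r : ZMod q, r ≠ 0 → IsSquare r →
        ∑ j : ZMod q,
          algebraMap (ZMod 2) (AlgebraicClosure (ZMod 2)) (c j) * (α ^ r.val) ^ j.val = 0

/-- Isomorphism of binary codes: equality up to a permutation of the coordinates. -/
def CodeIsomorphic {q : ℕ} (C D : BinaryCode q) : Prop :=
  ∃ σ : Equiv.Perm (ZMod q), ∀ c : ZMod q → ZMod 2, c ∈ C ↔ (fun j => c (σ j)) ∈ D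

open Classical in
/-- The expectation of `f c` for a uniformly random codeword `c` of `C`. -/
noncomputable def codeExpectation {q : ℕ} [NeZero q] (C : BinaryCode q)
    (f : (ZMod q → ZMod 2) → ℝ) : ℝ :=
  (∑ c : C, f c) / (Fintype.card C : ℝ)

/-- The probability that `P c₁ c₂` holds for two independent uniformly random codewords of `C`. -/
noncomputable def codePairProbability {q : ℕ} (C : BinaryCode q)
    (P : (ZMod q → ZMod 2) → (ZMod q → ZMod 2) → Prop) : ℝ :=
  (Nat.card {p : C × C // P p.1 p.2} : ℝ) / (Nat.card (C × C) : ℝ)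

/-! Everything is read off the discrete Fourier transform over a field of characteristic 2. Let `g`
be the residue word. Squaring a transform value doubles the frequency, and 2 is a residue, so the
transform of `g` takes only the values 0 and 1. As -1 is a nonresidue, its values at `r` and `-r`
add to 1 for `r ≠ 0`. After possibly inverting `α`, it is therefore 0 on nonzero residues and 1
elsewhere, so convolution with `g` projects onto the quadratic residue code. Another choice of `α`
only rescales the coordinates.

The code and its reversal span the whole space and meet in the constant words, which gives the
dimension. By `dotProduct_eq_mul_sum`, inner products of codewords are products of parities. Since
`g` has weight 3 mod 4, induction on sums then shows that every weight is 0 or 3 mod 4. Hence `q - 2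
wt(c)` is ±1 mod 8 and the squared cosine is constant on the code. Two codewords have nonzero
product only if both are odd, which has probability 1/4. -/

/-! ### Fourier transform and cyclic convolution of binary words -/

section Transform

variable {q : ℕ} [Fact q.Prime] {K : Type*} [Field K] [Algebra (ZMod 2) K]

/-- The discrete Fourier transform of a binary word with respect to an additive character. -/
def wordTransform (ψ : AddChar (ZMod q) K) (c : ZMod q → ZMod 2) (r : ZMod q) : K :=
  ∑ j, algebraMap (ZMod 2) K (c j) * ψ (r * j)

theorem wordTransform_add (ψ : AddChar (ZMod q) K) (a b : ZMod q → ZMod 2) (r : ZMod q) :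
    wordTransform ψ (a + b) r = wordTransform ψ a r + wordTransform ψ b r := by
  simp [wordTransform, add_mul, Finset.sum_add_distrib]

theorem wordTransform_smul (ψ : AddChar (ZMod q) K) (t : ZMod 2) (a : ZMod q → ZMod 2)
    (r : ZMod q) : wordTransform ψ (t • a) r = algebraMap _ K t * wordTransform ψ a r := by
  simp [wordTransform, mul_assoc, Finset.mul_sum]

theorem wordTransform_apply_zero (ψ : AddChar (ZMod q) K) (c : ZMod q → ZMod 2) :
    wordTransform ψ c 0 = algebraMap (ZMod 2) K (∑ j, c j) := by
  simp [wordTransform]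

/-- Multiplying the coordinates by a unit multiplies the frequencies by its inverse. -/
theorem wordTransform_comp_mul (ψ : AddChar (ZMod q) K) (c : ZMod q → ZMod 2) {t : ZMod q}
    (ht : t ≠ 0) (r : ZMod q) :
    wordTransform ψ (fun j => c (t * j)) (t * r) = wordTransform ψ c r := by
  unfold wordTransform
  refine Fintype.sum_equiv (Equiv.mulLeft₀ t ht) _ _ fun j => ?_
  change _ = algebraMap (ZMod 2) K (c (t * j)) * ψ (r * (t * j))
  rw [show t * r * j = r * (t * j) by ring]

theorem wordTransform_comp_neg (ψ : AddChar (ZMod q) K) (c : ZMod q → ZMod 2) (r : ZMod q) :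
    wordTransform ψ (fun j => c (-j)) r = wordTransform ψ c (-r) := by
  simpa using wordTransform_comp_mul ψ c (neg_ne_zero.mpr one_ne_zero) (-r)

/-- The cyclic convolution of two binary words. -/
def wordConvolution (a b : ZMod q → ZMod 2) : ZMod q → ZMod 2 :=
  fun k => ∑ s, a s * b (k - s)

theorem wordTransform_convolution (ψ : AddChar (ZMod q) K) (a b : ZMod q → ZMod 2)
    (r : ZMod q) :
    wordTransform ψ (wordConvolution a b) r = wordTransform ψ a r * wordTransform ψ b r := by
  simp only [wordTransform, wordConvolution, map_sum, map_mul, Finset.sum_mul]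
  rw [Finset.sum_comm]
  refine Finset.sum_congr rfl fun s _ => ?_
  rw [Finset.mul_sum]
  refine (Fintype.sum_equiv (Equiv.addRight s) _ _ fun j => ?_).symm
  simp only [Equiv.coe_addRight, add_sub_cancel_right, mul_add, AddChar.map_add_eq_mul]
  ring

theorem wordConvolution_mem_cyclicSpan (a b : ZMod q → ZMod 2) :
    wordConvolution a b ∈ cyclicSpan b := by
  have h : wordConvolution a b = ∑ s, a s • fun k => b (k - s) := by
    ext k
    simp [wordConvolution]
  rw [h]
  exact Submodule.sum_mem _ fun s _ =>
    Submodule.smul_mem _ _ (Submodule.subset_span (Set.mem_range_self s))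

theorem wordTransform_shift (ψ : AddChar (ZMod q) K) (c : ZMod q → ZMod 2) (s r : ZMod q) :
    wordTransform ψ (fun j => c (j - s)) r = ψ (r * s) * wordTransform ψ c r := by
  unfold wordTransform
  rw [Finset.mul_sum]
  refine (Fintype.sum_equiv (Equiv.addRight s) _ _ fun j => ?_).symm
  simp only [Equiv.coe_addRight, add_sub_cancel_right, mul_add, AddChar.map_add_eq_mul]
  ring

theorem wordTransform_eq_zero_of_mem_cyclicSpan (ψ : AddChar (ZMod q) K)
    {g c : ZMod q → ZMod 2} (hc : c ∈ cyclicSpan g) {r : ZMod q}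
    (hr : wordTransform ψ g r = 0) : wordTransform ψ c r = 0 := by
  induction hc using Submodule.span_induction with
  | mem x h =>
    obtain ⟨s, rfl⟩ := h
    rw [wordTransform_shift, hr, mul_zero]
  | zero => simp [wordTransform]
  | add x y _ _ hx hy => rw [wordTransform_add, hx, hy, add_zero]
  | smul t x _ hx => rw [wordTransform_smul, hx, mul_zero]

theorem wordTransform_inversion {ψ : AddChar (ZMod q) K} (hψ : ψ.IsPrimitive) (hq : Odd q)
    (c : ZMod q → ZMod 2) (k : ZMod q) :
    ∑ r, wordTransform ψ c r * ψ (r * -k) = algebraMap (ZMod 2) K (c k) := by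
  have : CharP K 2 := charP_of_injective_algebraMap (algebraMap (ZMod 2) K).injective 2
  -- The usual factor `1/q` in Fourier inversion disappears because `q` is odd.
  have hq1 : (q : K) = 1 := by
    obtain ⟨m, rfl⟩ := hq
    push_cast
    rw [CharTwo.two_eq_zero, zero_mul, zero_add]
  simp only [wordTransform, Finset.sum_mul]
  rw [Finset.sum_comm]
  have h : ∀ j : ZMod q, ∑ r, algebraMap (ZMod 2) K (c j) * ψ (r * j) * ψ (r * -k) =
      if j = k then algebraMap (ZMod 2) K (c j) else 0 := by
    intro j
    have h1 : ∀ r : ZMod q, algebraMap (ZMod 2) K (c j) * ψ (r * j) * ψ (r * -k) =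
        algebraMap (ZMod 2) K (c j) * ψ (r * (j - k)) := by
      intro r
      rw [mul_assoc, ← AddChar.map_add_eq_mul, sub_eq_add_neg, mul_add]
    simp_rw [h1]
    rw [← Finset.mul_sum, AddChar.sum_mulShift _ hψ]
    by_cases hjk : j = k
    · simp [hjk, hq1, ZMod.card]
    · simp [hjk, sub_eq_zero]
  simp_rw [h]
  simp

theorem wordTransform_injective {ψ : AddChar (ZMod q) K} (hψ : ψ.IsPrimitive) (hq : Odd q) :
    Function.Injective (wordTransform ψ) := by
  intro a b hab
  ext k
  apply (algebraMap (ZMod 2) K).injective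
  rw [← wordTransform_inversion hψ hq, ← wordTransform_inversion hψ hq, hab]

/-- A word whose transform is concentrated at frequency zero is constant. -/
theorem eq_sum_of_wordTransform_eq_zero {ψ : AddChar (ZMod q) K} (hψ : ψ.IsPrimitive)
    (hq : Odd q) {c : ZMod q → ZMod 2} (hc : ∀ r ≠ 0, wordTransform ψ c r = 0) (k : ZMod q) :
    c k = ∑ j, c j := by
  apply (algebraMap (ZMod 2) K).injective
  rw [← wordTransform_inversion hψ hq, Finset.sum_eq_single 0, wordTransform_apply_zero]
  · simp
  · intro r _ hr
    rw [hc r hr, zero_mul]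
  · simp

theorem wordTransform_one {ψ : AddChar (ZMod q) K} (hψ : ψ.IsPrimitive) {r : ZMod q}
    (hr : r ≠ 0) : wordTransform ψ (fun _ => 1) r = 0 := by
  have h := AddChar.sum_mulShift (ψ := ψ) r hψ
  simpa [wordTransform, mul_comm r, hr] using h

/-- If at each nonzero frequency one of `a` and the reversal of `b` has vanishing transform, then
the inner product of `a` and `b` is the product of their parities. -/
theorem dotProduct_eq_mul_sum {ψ : AddChar (ZMod q) K} (hψ : ψ.IsPrimitive) (hq : Odd q)
    {a b : ZMod q → ZMod 2}
    (h : ∀ r ≠ 0, wordTransform ψ a r = 0 ∨ wordTransform ψ b (-r) = 0) :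
    a ⬝ᵥ b = (∑ j, a j) * ∑ j, b j := by
  have h1 := eq_sum_of_wordTransform_eq_zero hψ hq
    (c := wordConvolution a fun j => b (-j)) (fun r hr => by
      rw [wordTransform_convolution, wordTransform_comp_neg]
      rcases h r hr with h | h <;> simp [h]) 0
  -- The convolution is constant, hence equal to its own sum; at frequency zero that sum is the
  -- product of the two parities, while its entry at 0 is the inner product.
  have h2 := wordTransform_convolution ψ a (fun j => b (-j)) 0
  rw [wordTransform_comp_neg, neg_zero, wordTransform_apply_zero, wordTransform_apply_zero,
    wordTransform_apply_zero, ← map_mul] at h2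
  rw [← (algebraMap (ZMod 2) K).injective h2, ← h1]
  simp [wordConvolution, dotProduct]

end Transform

/-! ### The residue word and its transform -/

section ResidueWord

variable {q : ℕ} [Fact q.Prime]

theorem odd_of_eight_dvd_succ {q : ℕ} (hq : 8 ∣ q + 1) : Odd q := by
  rw [Nat.odd_iff]
  omega

theorem zmod_isSquare_two (hq : 8 ∣ q + 1) : IsSquare (2 : ZMod q) :=
  (ZMod.exists_sq_eq_two_iff (by omega)).mpr (by omega)

theorem zmod_two_ne_zero (hq : 8 ∣ q + 1) : (2 : ZMod q) ≠ 0 := by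
  intro h
  have h2 : ((2 : ℕ) : ZMod q) = 0 := by exact_mod_cast h
  rw [ZMod.natCast_eq_zero_iff] at h2
  have := Nat.le_of_dvd two_pos h2
  omega

theorem zmod_isSquare_neg_iff (hq : 8 ∣ q + 1) {r : ZMod q} (hr : r ≠ 0) :
    IsSquare (-r) ↔ ¬ IsSquare r := by
  have hn : ¬ IsSquare (-1 : ZMod q) := by
    rw [ZMod.exists_sq_eq_neg_one_iff]
    omega
  constructor
  · intro h1 h2
    apply hn
    have := h1.div h2
    rwa [neg_div, div_self hr] at this
  · intro h
    have h2 : ringChar (ZMod q) ≠ 2 := by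
      rw [ZMod.ringChar_zmod_n]
      omega
    have ha : quadraticChar (ZMod q) r = -1 := quadraticChar_neg_one_iff_not_isSquare.mpr h
    have hb : quadraticChar (ZMod q) (-1) = -1 := quadraticChar_neg_one_iff_not_isSquare.mpr hn
    rw [← quadraticChar_one_iff_isSquare (neg_ne_zero.mpr hr), ← neg_one_mul, map_mul, ha, hb]
    norm_num

theorem residueWord_mul {s : ZMod q} (hs : s ≠ 0) (hs2 : IsSquare s) (j : ZMod q) :
    residueWord q (s * j) = residueWord q j := by
  have h : IsSquare (s * j) ↔ IsSquare j := by
    refine ⟨fun h => ?_, fun h => hs2.mul h⟩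
    have := h.div hs2
    rwa [mul_div_cancel_left₀ _ hs] at this
  simp [residueWord, h, hs]

theorem residueWord_add_neg (hq : 8 ∣ q + 1) {j : ZMod q} (hj : j ≠ 0) :
    (residueWord q j).val + (residueWord q (-j)).val = 1 := by
  unfold residueWord
  simp only [ne_eq, hj, neg_eq_zero, not_false_eq_true, true_and, zmod_isSquare_neg_iff hq hj]
  by_cases h : IsSquare j <;> simp [h, ZMod.val_one]

theorem residueWord_zero : residueWord q 0 = 0 := by
  simp [residueWord]

theorem hammingNorm_eq_sum_val {q : ℕ} [NeZero q] (c : ZMod q → ZMod 2) :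
    hammingNorm c = ∑ j, (c j).val := by
  rw [hammingNorm, Finset.card_filter]
  refine Finset.sum_congr rfl fun j _ => ?_
  generalize c j = x
  revert x
  decide

theorem natCast_hammingNorm {q : ℕ} [NeZero q] (c : ZMod q → ZMod 2) :
    (hammingNorm c : ZMod 2) = ∑ j, c j := by
  rw [hammingNorm_eq_sum_val]
  simp

theorem hammingNorm_comp_equiv {q : ℕ} [NeZero q] (c : ZMod q → ZMod 2)
    (σ : Equiv.Perm (ZMod q)) : hammingNorm (fun j => c (σ j)) = hammingNorm c := by
  rw [hammingNorm_eq_sum_val, hammingNorm_eq_sum_val]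
  exact Equiv.sum_comp σ fun j => (c j).val

theorem hammingNorm_add_add {q : ℕ} [NeZero q] (a b : ZMod q → ZMod 2) :
    hammingNorm (a + b) + 2 * hammingNorm (a * b) = hammingNorm a + hammingNorm b := by
  simp only [hammingNorm_eq_sum_val, Finset.mul_sum, ← Finset.sum_add_distrib, Pi.add_apply,
    Pi.mul_apply]
  refine Finset.sum_congr rfl fun j _ => ?_
  generalize a j = x
  generalize b j = y
  revert x y
  decide

theorem two_mul_hammingNorm_residueWord (hq : 8 ∣ q + 1) :
    2 * hammingNorm (residueWord q) + 1 = q := by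
  have h : ∑ j : ZMod q, ((residueWord q j).val + (residueWord q (-j)).val) =
      ∑ j : ZMod q, if j = 0 then 0 else 1 := by
    refine Finset.sum_congr rfl fun j _ => ?_
    split_ifs with hj
    · simp [hj, residueWord_zero]
    · exact residueWord_add_neg hq hj
  have h2 : ∑ j : ZMod q, (residueWord q (-j)).val = ∑ j : ZMod q, (residueWord q j).val :=
    Equiv.sum_comp (Equiv.neg _) fun j => (residueWord q j).val
  have h3 : (∑ j : ZMod q, if j = 0 then 0 else 1) + 1 = q := by
    have : ∑ j : ZMod q, ((if j = 0 then 0 else 1) + if j = 0 then 1 else 0) = q := by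
      rw [Finset.sum_congr rfl (g := fun _ => 1) fun j _ => by split_ifs <;> rfl]
      simp [ZMod.card]
    rw [Finset.sum_add_distrib] at this
    simpa using this
  rw [Finset.sum_add_distrib, h2, ← hammingNorm_eq_sum_val] at h
  omega

theorem sum_residueWord (hq : 8 ∣ q + 1) : ∑ j, residueWord q j = 1 := by
  have h := two_mul_hammingNorm_residueWord hq
  rw [← natCast_hammingNorm, ZMod.natCast_eq_one_iff_odd, Nat.odd_iff]
  omega

variable {K : Type*} [Field K] [Algebra (ZMod 2) K]

theorem wordTransform_residueWord_mul (ψ : AddChar (ZMod q) K) {s : ZMod q} (hs : s ≠ 0)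
    (hs2 : IsSquare s) (r : ZMod q) :
    wordTransform ψ (residueWord q) (s * r) = wordTransform ψ (residueWord q) r := by
  rw [← wordTransform_comp_mul ψ (residueWord q) hs r]
  simp_rw [residueWord_mul hs hs2]

/-- Frobenius fixes the binary coefficients and doubles the frequency; doubling has no effect
because 2 is a quadratic residue. -/
theorem wordTransform_residueWord_sq (hq : 8 ∣ q + 1) (ψ : AddChar (ZMod q) K) (r : ZMod q) :
    wordTransform ψ (residueWord q) r ^ 2 = wordTransform ψ (residueWord q) r := by
  have : CharP K 2 := charP_of_injective_algebraMap (algebraMap (ZMod 2) K).injective 2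
  conv_rhs => rw [← wordTransform_residueWord_mul ψ (zmod_two_ne_zero hq) (zmod_isSquare_two hq) r]
  unfold wordTransform
  rw [CharTwo.sum_sq]
  refine Finset.sum_congr rfl fun j _ => ?_
  rw [mul_pow, ← map_pow, show 2 * r * j = r * j + r * j by ring, AddChar.map_add_eq_mul, sq (ψ _)]
  congr 2
  generalize residueWord q j = x
  revert x
  decide

/-- Residues, their negatives and 0 partition the coordinates, and the all-one word has zero
transform at nonzero frequencies. -/
theorem wordTransform_residueWord_add_neg (hq : 8 ∣ q + 1) {ψ : AddChar (ZMod q) K}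
    (hψ : ψ.IsPrimitive) {r : ZMod q} (hr : r ≠ 0) :
    wordTransform ψ (residueWord q) r + wordTransform ψ (residueWord q) (-r) = 1 := by
  have : CharP K 2 := charP_of_injective_algebraMap (algebraMap (ZMod 2) K).injective 2
  have h : (residueWord q + (fun j => residueWord q (-j)) + Pi.single 0 1 : ZMod q → ZMod 2) =
      fun _ => 1 := by
    ext j : 1
    by_cases hj : j = 0
    · simp [hj, residueWord_zero]
    · have := congrArg (Nat.cast : ℕ → ZMod 2) (residueWord_add_neg hq hj)
      simpa [hj] using this
  have h2 := wordTransform_one hψ hr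
  rw [← h, wordTransform_add, wordTransform_add, wordTransform_comp_neg] at h2
  have h3 : wordTransform ψ (Pi.single 0 1) r = 1 := by
    unfold wordTransform
    rw [Finset.sum_eq_single 0]
    · simp
    · intro j _ hj
      simp [hj]
    · simp
  rw [h3, CharTwo.add_eq_zero] at h2
  exact h2

/-- If the transform of the residue word vanishes at frequency one, it vanishes at the nonzero
quadratic residues and equals one at all other frequencies. -/
theorem wordTransform_residueWord_of_residue (ψ : AddChar (ZMod q) K)
    (h1 : wordTransform ψ (residueWord q) 1 = 0) {r : ZMod q} (hr : r ≠ 0) (hr2 : IsSquare r) :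
    wordTransform ψ (residueWord q) r = 0 := by
  rw [← mul_one r, wordTransform_residueWord_mul ψ hr hr2, h1]

theorem wordTransform_residueWord_of_not_residue (hq : 8 ∣ q + 1) {ψ : AddChar (ZMod q) K}
    (hψ : ψ.IsPrimitive) (h1 : wordTransform ψ (residueWord q) 1 = 0) {r : ZMod q}
    (hr : ¬ (r ≠ 0 ∧ IsSquare r)) : wordTransform ψ (residueWord q) r = 1 := by
  by_cases h0 : r = 0
  · rw [h0, wordTransform_apply_zero, sum_residueWord hq, map_one]
  · have hs : IsSquare (-r) := (zmod_isSquare_neg_iff hq h0).mpr fun h => hr ⟨h0, h⟩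
    have := wordTransform_residueWord_add_neg hq hψ h0
    rwa [wordTransform_residueWord_of_residue ψ h1 (neg_ne_zero.mpr h0) hs, add_zero] at this

/-- A word whose transform vanishes at the nonzero residues is fixed by convolution with the residue
word, whose transform is 1 at all other frequencies; such a convolution is a combination of shifts.
-/
theorem mem_residueCode_iff (hq : 8 ∣ q + 1) {ψ : AddChar (ZMod q) K} (hψ : ψ.IsPrimitive)
    (h1 : wordTransform ψ (residueWord q) 1 = 0) (c : ZMod q → ZMod 2) :
    c ∈ residueCode q ↔ ∀ r, r ≠ 0 → IsSquare r → wordTransform ψ c r = 0 := by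
  constructor
  · intro hc r hr hr2
    exact wordTransform_eq_zero_of_mem_cyclicSpan ψ hc
      (wordTransform_residueWord_of_residue ψ h1 hr hr2)
  · intro h
    have hc : c = wordConvolution c (residueWord q) := by
      apply wordTransform_injective hψ (odd_of_eight_dvd_succ hq)
      ext r
      rw [wordTransform_convolution]
      by_cases hr : r ≠ 0 ∧ IsSquare r
      · rw [h r hr.1 hr.2, zero_mul]
      · rw [wordTransform_residueWord_of_not_residue hq hψ h1 hr, mul_one]
    rw [hc]
    exact wordConvolution_mem_cyclicSpan _ _

end ResidueWord

/-! ### Quadratic residue codes: existence, uniqueness, inner products -/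

section QuadraticResidueCode

variable {q : ℕ} [Fact q.Prime]

theorem zmodChar_mul_apply {K : Type*} [Field K] {α : K} (hα : α ^ q = 1) (r j : ZMod q) :
    AddChar.zmodChar q hα (r * j) = (α ^ r.val) ^ j.val := by
  rw [← AddChar.zmodChar_apply hα, ← AddChar.map_nsmul_eq_pow, nsmul_eq_mul, ZMod.natCast_val,
    ZMod.cast_id, mul_comm]

theorem isQuadraticResidueCode_iff (C : BinaryCode q) :
    IsQuadraticResidueCode q C ↔ ∃ (α : AlgebraicClosure (ZMod 2)) (h : IsPrimitiveRoot α q),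
      ∀ c, c ∈ C ↔ ∀ r, r ≠ 0 → IsSquare r →
        wordTransform (AddChar.zmodChar q h.pow_eq_one) c r = 0 := by
  simp only [IsQuadraticResidueCode, wordTransform, zmodChar_mul_apply, exists_prop]

/-- The values at frequencies 1 and -1 are idempotents with sum 1, so one of them vanishes, and
inverting `α` swaps them. -/
theorem exists_wordTransform_residueWord_eq_zero (hq : 8 ∣ q + 1) :
    ∃ (α : AlgebraicClosure (ZMod 2)) (h : IsPrimitiveRoot α q),
      wordTransform (AddChar.zmodChar q h.pow_eq_one) (residueWord q) 1 = 0 := by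
  have : NeZero (q : AlgebraicClosure (ZMod 2)) := by
    refine ⟨?_⟩
    rw [Ne, CharP.cast_eq_zero_iff (AlgebraicClosure (ZMod 2)) 2]
    omega
  obtain ⟨α, h⟩ := HasEnoughRootsOfUnity.exists_primitiveRoot (AlgebraicClosure (ZMod 2)) q
  by_cases h0 : wordTransform (AddChar.zmodChar q h.pow_eq_one) (residueWord q) 1 = 0
  · exact ⟨α, h, h0⟩
  · refine ⟨α⁻¹, h.inv, ?_⟩
    have h1 : wordTransform (AddChar.zmodChar q h.pow_eq_one) (residueWord q) 1 = 1 := by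
      have := wordTransform_residueWord_sq hq (AddChar.zmodChar q h.pow_eq_one) 1
      rw [sq] at this
      exact mul_right_cancel₀ h0 (this.trans (one_mul _).symm)
    have h2 := wordTransform_residueWord_add_neg hq
      (AddChar.zmodChar_primitive_of_primitive_root q h) one_ne_zero
    rw [h1, add_eq_left] at h2
    rw [← h2]
    unfold wordTransform
    refine Finset.sum_congr rfl fun j _ => ?_
    rw [neg_one_mul, one_mul, AddChar.map_neg_eq_inv, AddChar.zmodChar_apply,
      AddChar.zmodChar_apply, inv_pow]

theorem isQuadraticResidueCode_residueCode (hq : 8 ∣ q + 1) :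
    IsQuadraticResidueCode q (residueCode q) := by
  obtain ⟨α, h, h0⟩ := exists_wordTransform_residueWord_eq_zero (q := q) hq
  exact (isQuadraticResidueCode_iff _).mpr ⟨α, h,
    mem_residueCode_iff hq (AddChar.zmodChar_primitive_of_primitive_root q h) h0⟩

/-- If `β = α ^ i`, then frequency `r` for `β` is frequency `i * r` for `α`, which multiplying the
coordinates by `i` undoes. Whether `i` is a residue plays no role. -/
theorem IsQuadraticResidueCode.codeIsomorphic {C D : BinaryCode q}
    (hC : IsQuadraticResidueCode q C) (hD : IsQuadraticResidueCode q D) :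
    CodeIsomorphic C D := by
  obtain ⟨α, hα, hC⟩ := (isQuadraticResidueCode_iff C).mp hC
  obtain ⟨β, hβ, hD⟩ := (isQuadraticResidueCode_iff D).mp hD
  obtain ⟨i, -, hi⟩ := hα.eq_pow_of_pow_eq_one hβ.pow_eq_one
  have hψ : ∀ a : ZMod q, AddChar.zmodChar q hβ.pow_eq_one a =
      AddChar.zmodChar q hα.pow_eq_one ((i : ZMod q) * a) := by
    intro a
    rw [← nsmul_eq_mul, AddChar.map_nsmul_eq_pow, AddChar.zmodChar_apply,
      AddChar.zmodChar_apply, ← hi, ← pow_mul, ← pow_mul, mul_comm]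
  have ht : (i : ZMod q) ≠ 0 := by
    intro h
    rw [ZMod.natCast_eq_zero_iff] at h
    rw [(hα.pow_eq_one_iff_dvd i).mpr h] at hi
    exact hβ.ne_one (Fact.out : q.Prime).one_lt hi.symm
  refine ⟨Equiv.mulLeft₀ _ ht, fun c => ?_⟩
  rw [hC, hD]
  refine forall_congr' fun r => ?_
  rw [← wordTransform_comp_mul _ c ht r]
  simp only [wordTransform, hψ, mul_assoc]
  rfl

theorem IsQuadraticResidueCode.one_mem {C : BinaryCode q} (hC : IsQuadraticResidueCode q C) :
    (fun _ => 1) ∈ C := by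
  obtain ⟨α, hα, hC⟩ := (isQuadraticResidueCode_iff C).mp hC
  rw [hC]
  exact fun r hr _ =>
    wordTransform_one (AddChar.zmodChar_primitive_of_primitive_root q hα) hr

/-- For `r ≠ 0`, one of `r` and `-r` is a residue, so `dotProduct_eq_mul_sum` applies. -/
theorem IsQuadraticResidueCode.dotProduct_eq (hq : 8 ∣ q + 1) {C : BinaryCode q}
    (hC : IsQuadraticResidueCode q C) {a b : ZMod q → ZMod 2} (ha : a ∈ C) (hb : b ∈ C) :
    a ⬝ᵥ b = (∑ j, a j) * ∑ j, b j := by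
  obtain ⟨α, hα, hC⟩ := (isQuadraticResidueCode_iff C).mp hC
  rw [hC] at ha hb
  refine dotProduct_eq_mul_sum (AddChar.zmodChar_primitive_of_primitive_root q hα)
    (odd_of_eight_dvd_succ hq) fun r hr => ?_
  by_cases h : IsSquare r
  · exact Or.inl (ha r hr h)
  · exact Or.inr (hb (-r) (neg_ne_zero.mpr hr) ((zmod_isSquare_neg_iff hq hr).mpr h))

/-! ### Dimension -/

theorem finrank_residueCode (hq : 8 ∣ q + 1) :
    Module.finrank (ZMod 2) (residueCode q) = (q + 1) / 2 := by
  obtain ⟨α, h, h0⟩ := exists_wordTransform_residueWord_eq_zero (q := q) hq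
  have hψ := AddChar.zmodChar_primitive_of_primitive_root q h
  set ψ := AddChar.zmodChar q h.pow_eq_one
  have : CharP (AlgebraicClosure (ZMod 2)) 2 := inferInstance
  have hodd := odd_of_eight_dvd_succ hq
  let e := LinearEquiv.funCongrLeft (ZMod 2) (ZMod 2) (Equiv.neg (ZMod q))
  -- The reversed code has the same dimension and its transforms vanish on the nonresidues. The sum
  -- of the two codes has dimension `q` and the intersection dimension 1, so twice the dimension is
  -- `q + 1`.
  let R := (residueCode q).map (e : (ZMod q → ZMod 2) →ₗ[ZMod 2] (ZMod q → ZMod 2))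
  have hR : ∀ c, c ∈ R ↔ ∀ r, r ≠ 0 → ¬ IsSquare r → wordTransform ψ c r = 0 := by
    intro c
    have h1 : c ∈ R ↔ (fun j => c (-j)) ∈ residueCode q := by
      rw [Submodule.mem_map_equiv]
      rfl
    rw [h1, mem_residueCode_iff hq hψ h0]
    simp only [wordTransform_comp_neg]
    constructor
    · intro hc r hr hr2
      have := hc (-r) (neg_ne_zero.mpr hr) ((zmod_isSquare_neg_iff hq hr).mpr hr2)
      rwa [neg_neg] at this
    · intro hc r hr hr2
      exact hc (-r) (neg_ne_zero.mpr hr) fun h => (zmod_isSquare_neg_iff hq hr).mp h hr2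
  have hsup : residueCode q ⊔ R = ⊤ := by
    rw [eq_top_iff]
    intro c _
    -- Convolution with the residue word preserves the transform at nonresidues, so the remainder
    -- vanishes there.
    have hc : wordConvolution c (residueWord q) + (c - wordConvolution c (residueWord q)) = c :=
      add_sub_cancel _ _
    rw [← hc]
    refine Submodule.add_mem_sup (wordConvolution_mem_cyclicSpan _ _) ((hR _).mpr ?_)
    intro r hr hr2
    have h2 := congrArg (fun w => wordTransform ψ w r) hc
    simp only [wordTransform_add] at h2
    rwa [wordTransform_convolution, wordTransform_residueWord_of_not_residue hq hψ h0
      (fun h => hr2 h.2), mul_one, add_eq_left] at h2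
  have hinf : residueCode q ⊓ R = Submodule.span (ZMod 2) {fun _ => 1} := by
    ext c
    rw [Submodule.mem_inf, hR, mem_residueCode_iff hq hψ h0, Submodule.mem_span_singleton]
    constructor
    · rintro ⟨h1, h2⟩
      refine ⟨∑ j, c j, ?_⟩
      ext k : 1
      rw [eq_sum_of_wordTransform_eq_zero hψ hodd (c := c) (fun r hr => ?_) k]
      · simp
      · by_cases hs : IsSquare r
        · exact h1 r hr hs
        · exact h2 r hr hs
    · rintro ⟨t, rfl⟩
      constructor <;>
      · intro r hr _
        rw [wordTransform_smul, wordTransform_one hψ hr, mul_zero]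
  have hdim := Submodule.finrank_sup_add_finrank_inf_eq (residueCode q) R
  rw [hsup, hinf, finrank_top, Module.finrank_fintype_fun_eq_card, ZMod.card,
    finrank_span_singleton (fun h => one_ne_zero (congrFun h 0)), LinearEquiv.finrank_map_eq]
    at hdim
  omega

theorem CodeIsomorphic.finrank_eq {q : ℕ} {C D : BinaryCode q} (h : CodeIsomorphic C D) :
    Module.finrank (ZMod 2) C = Module.finrank (ZMod 2) D := by
  obtain ⟨σ, hσ⟩ := h
  have hC : C = D.map ((LinearEquiv.funCongrLeft (ZMod 2) (ZMod 2) σ).symm :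
      (ZMod q → ZMod 2) →ₗ[ZMod 2] (ZMod q → ZMod 2)) := by
    ext c
    rw [hσ, Submodule.mem_map_equiv]
    rfl
  rw [hC, LinearEquiv.finrank_map_eq]

/-! ### Weights modulo four and the cosine expectation -/

/-- All weights in the residue code are congruent to zero or three modulo four. -/
theorem hammingNorm_mod_four_of_mem_residueCode (hq : 8 ∣ q + 1) {c : ZMod q → ZMod 2}
    (hc : c ∈ residueCode q) : hammingNorm c % 4 = 0 ∨ hammingNorm c % 4 = 3 := by
  have hz : hammingNorm (0 : ZMod q → ZMod 2) % 4 = 0 ∨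
      hammingNorm (0 : ZMod q → ZMod 2) % 4 = 3 := by simp
  induction hc using Submodule.span_induction with
  | mem x h =>
    obtain ⟨s, rfl⟩ := h
    right
    have h1 : hammingNorm (fun j => residueWord q (j - s)) = hammingNorm (residueWord q) :=
      hammingNorm_comp_equiv (residueWord q) (Equiv.subRight s)
    have h2 := two_mul_hammingNorm_residueWord (q := q) hq
    rw [h1]
    omega
  | zero => exact hz
  | add x y hx hy ihx ihy =>
    have h1 := hammingNorm_add_add x y
    have h2 := (isQuadraticResidueCode_residueCode hq).dotProduct_eq hq hx hy
    -- The overlap enters the weight of the sum with factor 2, so its parity suffices modulo 4. By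
    -- the inner product formula it is odd exactly when both weights are odd, and then 3 + 3 - 2 is
    -- 0 mod 4.
    have h3 : ((hammingNorm (x * y) : ℕ) : ZMod 2) =
        ((hammingNorm x * hammingNorm y : ℕ) : ZMod 2) := by
      rw [Nat.cast_mul, natCast_hammingNorm, natCast_hammingNorm, natCast_hammingNorm, ← h2]
      rfl
    rw [ZMod.natCast_eq_natCast_iff'] at h3
    rw [Nat.mul_mod] at h3
    rcases ihx with ihx | ihx <;> rcases ihy with ihy | ihy <;>
    · have hx2 : hammingNorm x % 2 = hammingNorm x % 4 % 2 := by omega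
      have hy2 : hammingNorm y % 2 = hammingNorm y % 4 % 2 := by omega
      rw [hx2, hy2, ihx, ihy] at h3
      omega
  | smul t x _ ihx =>
    have ht : t = 0 ∨ t = 1 := by
      revert t
      decide
    rcases ht with rfl | rfl
    · rwa [zero_smul]
    · rwa [one_smul]

theorem IsQuadraticResidueCode.hammingNorm_mod_four (hq : 8 ∣ q + 1) {C : BinaryCode q}
    (hC : IsQuadraticResidueCode q C) {c : ZMod q → ZMod 2} (hc : c ∈ C) :
    hammingNorm c % 4 = 0 ∨ hammingNorm c % 4 = 3 := by
  obtain ⟨σ, hσ⟩ := hC.codeIsomorphic (isQuadraticResidueCode_residueCode hq)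
  rw [← hammingNorm_comp_equiv c σ]
  exact hammingNorm_mod_four_of_mem_residueCode hq ((hσ c).mp hc)

/-- Here `q - 2 * w` is -1 or 1 modulo 8, and the squared cosine is even with period `π`. -/
theorem cos_sq_pi_div_eight_mul {q w : ℕ} (hq : 8 ∣ q + 1) (hw : w % 4 = 0 ∨ w % 4 = 3) :
    Real.cos (Real.pi / 8 * ((q : ℝ) - 2 * (w : ℝ))) ^ 2 = Real.cos (Real.pi / 8) ^ 2 := by
  have h : ∃ n : ℤ, (q : ℤ) - 2 * w = -1 + 8 * n ∨ (q : ℤ) - 2 * w = 1 + 8 * n := by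
    obtain ⟨m, hm⟩ := hq
    rcases hw with hw | hw
    · exact ⟨m - w / 4, Or.inl (by omega)⟩
    · exact ⟨m - w / 4 - 1, Or.inr (by omega)⟩
  obtain ⟨n, hn | hn⟩ := h
  · have hr : (q : ℝ) - 2 * w = -1 + 8 * n := by exact_mod_cast hn
    rw [hr, show Real.pi / 8 * (-1 + 8 * n) = -(Real.pi / 8) + n * Real.pi by ring,
      Real.cos_add_int_mul_pi, mul_pow, Real.cos_neg, ← zpow_natCast, ← zpow_mul, mul_comm n,
      zpow_mul]
    simp
  · have hr : (q : ℝ) - 2 * w = 1 + 8 * n := by exact_mod_cast hn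
    rw [hr, show Real.pi / 8 * (1 + 8 * n) = Real.pi / 8 + n * Real.pi by ring,
      Real.cos_add_int_mul_pi, mul_pow, ← zpow_natCast, ← zpow_mul, mul_comm n, zpow_mul]
    simp

theorem codeExpectation_eq_of_forall {q : ℕ} [NeZero q] (C : BinaryCode q)
    {f : (ZMod q → ZMod 2) → ℝ} {x : ℝ} (h : ∀ c ∈ C, f c = x) : codeExpectation C f = x := by
  classical
  unfold codeExpectation
  rw [Finset.sum_congr rfl fun c _ => h c.1 c.2, Finset.sum_const, Finset.card_univ, nsmul_eq_mul]
  refine mul_div_cancel_left₀ x (Nat.cast_ne_zero.mpr ?_)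
  exact Fintype.card_ne_zero

/-! ### Probability of orthogonality -/

theorem IsQuadraticResidueCode.codePairProbability_eq (hq : 8 ∣ q + 1) {C : BinaryCode q}
    (hC : IsQuadraticResidueCode q C) :
    codePairProbability C (fun a b => a ⬝ᵥ b = 0) = 3 / 4 := by
  classical
  let p : C → ℕ := fun c => (∑ j, c.1 j).val
  -- Adding the all-one word, of odd length `q`, flips parity, so exactly half of the codewords are
  -- odd.
  let u : C := ⟨fun _ => 1, hC.one_mem⟩
  have hu : ∀ c, p c + p (c + u) = 1 := by
    intro c
    have hs : ∑ j, (c + u).1 j = ∑ j, c.1 j + 1 := by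
      have h1 : ∑ _j : ZMod q, (1 : ZMod 2) = 1 := by
        rw [Finset.sum_const, Finset.card_univ, ZMod.card, nsmul_one,
          ZMod.natCast_eq_one_iff_odd]
        exact odd_of_eight_dvd_succ hq
      rw [← h1, ← Finset.sum_add_distrib]
      rfl
    simp only [p, hs]
    generalize ∑ j, c.1 j = x
    revert x
    decide
  have h2 : 2 * ∑ c, p c = Nat.card C := by
    have h := Finset.sum_congr rfl fun c (_ : c ∈ Finset.univ) => hu c
    have hshift : ∑ c, p (c + u) = ∑ c, p c := Equiv.sum_comp (Equiv.addRight u) p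
    rw [Finset.sum_add_distrib, hshift] at h
    rw [two_mul, h]
    simp
  -- The pairs with nonzero product are the pairs of odd codewords; `∑ c, p c` counts the odd ones.
  have h3 : Nat.card {x : C × C // x.1.1 ⬝ᵥ x.2.1 = 0} + (∑ c, p c) * ∑ c, p c =
      Nat.card C * Nat.card C := by
    rw [← Nat.card_prod, Nat.card_eq_fintype_card, Nat.card_eq_fintype_card,
      Fintype.card_subtype, Finset.card_filter, Finset.sum_mul_sum, ← Fintype.sum_prod_type',
      ← Finset.sum_add_distrib, Fintype.card_eq_sum_ones]
    refine Finset.sum_congr rfl fun x _ => ?_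
    rw [hC.dotProduct_eq hq x.1.2 x.2.2]
    simp only [p]
    generalize ∑ j, x.1.1 j = a
    generalize ∑ j, x.2.1 j = b
    revert a b
    decide
  have hpos : 0 < Nat.card C := Nat.card_pos
  unfold codePairProbability
  rw [Nat.card_prod, div_eq_div_iff (by positivity) (by norm_num)]
  have h4 : Nat.card {x : C × C // x.1.1 ⬝ᵥ x.2.1 = 0} * 4 = 3 * (Nat.card C * Nat.card C) := by
    rw [← h2] at h3 ⊢
    linarith
  exact_mod_cast h4

theorem abs_cos_sq_pi_div_eight_sub_lt : |Real.cos (Real.pi / 8) ^ 2 - 0.854| < 0.0005 := by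
  rw [Real.cos_pi_div_eight, div_pow, Real.sq_sqrt (by positivity), abs_lt]
  have h1 : (1.4142 : ℝ) < √2 := Real.lt_sqrt_of_sq_lt (by norm_num)
  have h2 : √2 < 1.4143 := (Real.sqrt_lt' (by norm_num)).mpr (by norm_num)
  constructor <;> norm_num at * <;> linarith

end QuadraticResidueCode

theorem lemma3 (q : ℕ) [Fact q.Prime] (hq : 8 ∣ q + 1) :
    IsQuadraticResidueCode q (residueCode q) ∧
    (∀ C D : BinaryCode q, IsQuadraticResidueCode q C → IsQuadraticResidueCode q D →
      CodeIsomorphic C D) ∧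
    (∀ C : BinaryCode q, IsQuadraticResidueCode q C →
      Module.finrank (ZMod 2) C = (q + 1) / 2 ∧
      codeExpectation C
        (fun c => Real.cos (Real.pi / 8 * ((q : ℝ) - 2 * (hammingNorm c : ℝ))) ^ 2) =
          Real.cos (Real.pi / 8) ^ 2 ∧
      codePairProbability C (fun c₁ c₂ => c₁ ⬝ᵥ c₂ = 0) = 3 / 4) ∧
    |Real.cos (Real.pi / 8) ^ 2 - 0.854| < 0.0005 := by
  refine ⟨isQuadraticResidueCode_residueCode hq, fun _ _ hC hD => hC.codeIsomorphic hD,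
    fun C hC => ⟨?_, ?_, hC.codePairProbability_eq hq⟩, abs_cos_sq_pi_div_eight_sub_lt⟩
  · rw [(hC.codeIsomorphic (isQuadraticResidueCode_residueCode hq)).finrank_eq,
      finrank_residueCode hq]
  · exact codeExpectation_eq_of_forall C fun c hc =>
      cos_sq_pi_div_eight_mul hq (hC.hammingNorm_mod_four hq hc)
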